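/- Let $G=(V,E)$ be a finite simple graph with at least one edge. Let $n^+$ and $n^-$ be the numbers, counted with multiplicity, of positive and of negative eigenvalues of its adjacency matrix; both are positive. Let $\chi_f(G)$ be the fractional chromatic number: the minimum of $\sum_{J}\sigma_J$ over all assignments of weights $\sigma_J\ge 0$ to the independent sets $J$ of $G$ such that $\sum_{J\ni v}\sigma_J\ge 1$ for every vertex $v$. Let $\xi_f(G)$ be the projective rank: the infimum of $d/r$ over all integers $d,r\ge 1$ for which there are orthogonal projectors $P_v\in\mathbb C^{d\times d}$ $(v\in V)$ of rank $r$ with $P_vP_w=0$ for every edge $vw\in E$. Then $$\chi_f(G)\;\ge\;\xi_f(G)\;\ge\;1+\max\left\{\frac{n^+}{n^-},\frac{n^-}{n^+}\right\}.$$ -/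

import Mathlib

namespace SimpleGraph

section Inertia

variable {V : Type*} [Fintype V] [DecidableEq V] (G : SimpleGraph V) [DecidableRel G.Adj]

theorem adjMatrix_real_isHermitian : (G.adjMatrix ℝ).IsHermitian := by
  rw [Matrix.IsHermitian, Matrix.conjTranspose_eq_transpose_of_trivial]
  exact G.isSymm_adjMatrix

/-- The number `n⁺` of positive eigenvalues of the adjacency matrix, counted with multiplicity. -/
noncomputable def posInertia : ℕ :=
  Fintype.card {i : V // 0 < G.adjMatrix_real_isHermitian.eigenvalues i}

/-- The number `n⁻` of negative eigenvalues of the adjacency matrix, counted with multiplicity. -/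
noncomputable def negInertia : ℕ :=
  Fintype.card {i : V // G.adjMatrix_real_isHermitian.eigenvalues i < 0}

end Inertia

section Fractional

variable {V : Type*} [Fintype V] (G : SimpleGraph V)

/-- The type of all independent sets of `G` (the empty set included). -/
abbrev IndepSets : Type _ := {J : Finset V // G.IsIndepSet (J : Set V)}

noncomputable instance : Fintype G.IndepSets := Fintype.ofFinite _

open Classical in
/-- A fractional coloring: a nonnegative weight on the independent sets such that, for every
vertex, the independent sets containing it have total weight at least `1`. -/
def IsFractionalColoring (σ : G.IndepSets → ℝ) : Prop :=
  (∀ J, 0 ≤ σ J) ∧ ∀ v : V, 1 ≤ ∑ J : G.IndepSets with v ∈ J.1, σ J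

/-- The total weights of the fractional colorings of `G`. -/
def fractionalColoringWeights : Set ℝ :=
  {x | ∃ σ : G.IndepSets → ℝ, G.IsFractionalColoring σ ∧ ∑ J, σ J = x}

/-- The fractional chromatic number `χ_f(G)`. The infimum is attained, as the next theorem
shows. -/
noncomputable def fractionalChromaticNumber : ℝ := sInf G.fractionalColoringWeights

theorem isLeast_fractionalChromaticNumber :
    IsLeast G.fractionalColoringWeights G.fractionalChromaticNumber := by
  classical
  suffices h : ∃ x, IsLeast G.fractionalColoringWeights x by
    obtain ⟨x, hx⟩ := h
    rw [fractionalChromaticNumber, hx.csInf_eq]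
    exact hx
  -- cutting a fractional coloring off at 1 gives a fractional coloring
  have trunc : ∀ σ, G.IsFractionalColoring σ →
      G.IsFractionalColoring (fun J => min (σ J) 1) := by
    rintro σ ⟨h0, h1⟩
    have hnn : ∀ J, 0 ≤ min (σ J) 1 := fun J => le_min (h0 J) zero_le_one
    refine ⟨hnn, fun v => ?_⟩
    by_cases hex : ∃ J : G.IndepSets, v ∈ J.1 ∧ 1 ≤ σ J
    · obtain ⟨J, hJ, h⟩ := hex
      calc (1 : ℝ) = min (σ J) 1 := (min_eq_right h).symm
        _ ≤ _ := Finset.single_le_sum (f := fun J : G.IndepSets => min (σ J) 1)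
          (fun J _ => hnn J) (by simpa using hJ)
    · push Not at hex
      refine (h1 v).trans (le_of_eq (Finset.sum_congr rfl fun J hJ => ?_))
      exact (min_eq_left (hex J (by simpa using hJ)).le).symm
  let K : Set (G.IndepSets → ℝ) := Set.Icc 0 1 ∩ {σ | G.IsFractionalColoring σ}
  have hK : IsCompact K := by
    refine isCompact_Icc.inter_right ?_
    have : {σ | G.IsFractionalColoring σ} = (⋂ J, {σ | 0 ≤ σ J}) ∩
        ⋂ v : V, {σ | 1 ≤ ∑ J : G.IndepSets with v ∈ J.1, σ J} := by
      ext σ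
      simp [IsFractionalColoring]
    rw [this]
    refine (isClosed_iInter fun J => ?_).inter (isClosed_iInter fun v => ?_)
    · exact isClosed_le continuous_const (continuous_apply J)
    · exact isClosed_le continuous_const (by fun_prop)
  have hone : (1 : G.IndepSets → ℝ) ∈ K := by
    refine ⟨⟨zero_le_one, le_rfl⟩, fun J => zero_le_one, fun v => ?_⟩
    exact Finset.single_le_sum (f := fun _ : G.IndepSets => (1 : ℝ))
      (a := ⟨{v}, by simp [IsIndepSet]⟩) (fun J _ => zero_le_one) (by simp)
  obtain ⟨σ, hσ, hmin⟩ := hK.exists_isMinOn ⟨1, hone⟩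
    (f := fun σ : G.IndepSets → ℝ => ∑ J, σ J) (by fun_prop)
  refine ⟨∑ J, σ J, ⟨σ, hσ.2, rfl⟩, ?_⟩
  rintro x ⟨τ, hτ, rfl⟩
  have hmem : (fun J => min (τ J) 1) ∈ K :=
    ⟨⟨fun J => le_min (hτ.1 J) zero_le_one, fun J => min_le_right _ _⟩, trunc τ hτ⟩
  exact (hmin hmem).trans (Finset.sum_le_sum fun J _ => min_le_left _ _)

end Fractional

section Projective

variable {V : Type*} (G : SimpleGraph V)

/-- `P` is a `d/r`-representation of `G`: orthogonal projectors (self-adjoint idempotents) in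
`ℂ^{d × d}` of rank `r`, with product zero along the edges. -/
def IsProjectiveRepresentation (d r : ℕ) (P : V → Matrix (Fin d) (Fin d) ℂ) : Prop :=
  (∀ v, IsStarProjection (P v)) ∧ (∀ v, (P v).rank = r) ∧ ∀ v w, G.Adj v w → P v * P w = 0

/-- The values `d / r`, `r ≥ 1`, for which `G` has a `d/r`-representation. -/
def projectiveRankValues : Set ℝ :=
  {x | ∃ d r : ℕ, 0 < r ∧ (∃ P, G.IsProjectiveRepresentation d r P) ∧ x = (d : ℝ) / r}

/-- The projective rank `ξ_f(G)`; for finite `G` the infimum is over a nonempty set of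
nonnegative reals. -/
noncomputable def projectiveRank : ℝ := sInf G.projectiveRankValues

theorem bddBelow_projectiveRankValues : BddBelow G.projectiveRankValues :=
  ⟨0, by rintro x ⟨d, r, -, -, rfl⟩; positivity⟩

theorem projectiveRankValues_nonempty [Finite V] : G.projectiveRankValues.Nonempty := by
  classical
  have := Fintype.ofFinite V
  let e := Fintype.equivFin V
  refine ⟨_, Fintype.card V, 1, one_pos,
    ⟨fun v => Matrix.diagonal (Pi.single (e v) 1), ?_, ?_, ?_⟩, rfl⟩
  · intro v
    refine ⟨?_, ?_⟩
    · rw [IsIdempotentElem, Matrix.diagonal_mul_diagonal]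
      congr 1; ext i
      by_cases h : i = e v <;> simp [Pi.single_apply, h]
    · rw [IsSelfAdjoint, Matrix.star_eq_conjTranspose, Matrix.diagonal_conjTranspose]
      congr 1; ext i
      by_cases h : i = e v <;> simp [Pi.single_apply, h]
  · intro v
    rw [Matrix.rank_diagonal]
    simp [Pi.single_apply, Fintype.card_subtype]
  · intro v w h
    rw [Matrix.diagonal_mul_diagonal, ← Matrix.diagonal_zero]
    congr 1; ext i
    have : e v ≠ e w := fun hh => h.ne (e.injective hh)
    by_cases h : i = e v <;> simp [Pi.single_apply, h, this]

end Projective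

end SimpleGraph

/-!
Let `P` be a `d/r`-representation of `G` and let `U v` be the range of `P v`, an `r`-dimensional
subspace of `ℂ^d`. Let `lam i` and `φ i` be the eigenvalues and an orthonormal eigenbasis of the
adjacency matrix. For a family `y` of vectors `y v ∈ U v` put `g i = ∑ v, φ i v • y v`. The ranges
of adjacent vertices are orthogonal, so that
`∑ i, lam i * ‖g i‖ ^ 2 = ∑ v w, A v w * ⟪y v, y w⟫ = 0`.

Fix a common complement `K` of all the `U v`, and suppose that `g i = 0` whenever `lam i < 0` and
that `g i ∈ K` whenever `lam i = 0`. The displayed identity then makes the remaining `g i` vanish,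
so every `g i`, hence every `y v = ∑ i, φ i v • g i`, lies in `K`, and `y = 0` because `K` meets
`U v` trivially. These linear conditions, `d * n⁻ + r * n⁰` in number, thus cut the
`|V| * r`-dimensional space of families down to zero, so `|V| * r ≤ d * n⁻ + r * n⁰`, that is,
`r * (n⁺ + n⁻) ≤ d * n⁻` (`inertia_bound`). The argument only uses the factorization
`A = ∑ i, lam i • φ i (φ i)ᵀ`, so it applies to `-A` too, with `n⁺` and `n⁻` interchanged.

For `ξ_f ≤ χ_f`, scale an optimal fractional coloring by a large `N` and round the weights up to
integers. Each vertex then lies in at least `N` of the independent sets counted with multiplicity,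
and coordinate projectors onto `N` of them give a representation whose ratio exceeds `χ_f` by
`O(1 / N)` (`exists_isProjectiveRepresentation_of_multiset`).
-/

/-! ### Common complements -/

/-- Over an infinite field, finitely many `r`-dimensional subspaces `U v` have a common complement
(take `m = finrank k E - r`). Induction on `m`: while `m + r < finrank k E`, the proper subspaces
`K ⊔ U v` do not cover `E`, so `K` can be enlarged by a vector outside all of them. -/
theorem exists_disjoint_of_finrank_add_le {k E ι : Type*} [Field k] [Infinite k] [AddCommGroup E]
    [Module k E] [FiniteDimensional k E] [Finite ι] (U : ι → Submodule k E) {r : ℕ}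
    (hU : ∀ v, Module.finrank k (U v) = r) (m : ℕ) (hm : m + r ≤ Module.finrank k E) :
    ∃ K : Submodule k E, Module.finrank k K = m ∧ ∀ v, Disjoint K (U v) := by
  induction m with
  | zero => exact ⟨⊥, by simp, fun v => disjoint_bot_left⟩
  | succ m ih =>
    obtain ⟨K, hK, hd⟩ := ih (by omega)
    have hsup : ∀ v, Module.finrank k (K ⊔ U v : Submodule k E) = m + r := fun v => by
      have h := Submodule.finrank_sup_add_finrank_inf_eq K (U v)
      rw [(hd v).eq_bot, finrank_bot, hK, hU] at h
      simpa using h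
    obtain ⟨x, hxK, hx⟩ : ∃ x, x ∉ K ∧ ∀ v, x ∉ K ⊔ U v := by
      have := Fintype.ofFinite ι
      classical
      by_contra! hcon
      let f : Option ι → Submodule k E := fun o => o.elim K fun v => K ⊔ U v
      refine Subspace.biUnion_ne_univ_of_top_notMem (s := Finset.univ.image f) ?_ ?_
      · intro h
        obtain ⟨o, -, ho⟩ := Finset.mem_image.1 h
        have h2 : Module.finrank k (f o) = Module.finrank k E := by rw [ho, finrank_top]
        cases o with
        | none => change Module.finrank k K = _ at h2; omega
        | some v =>
          have := hsup v
          change Module.finrank k (K ⊔ U v : Submodule k E) = _ at h2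
          omega
      · refine Set.eq_univ_of_forall fun x => ?_
        simp only [Set.mem_iUnion]
        by_cases hxK : x ∈ K
        · exact ⟨K, Finset.mem_image.2 ⟨none, Finset.mem_univ _, rfl⟩, hxK⟩
        · obtain ⟨v, hv⟩ := hcon x hxK
          exact ⟨K ⊔ U v, Finset.mem_image.2 ⟨some v, Finset.mem_univ _, rfl⟩, hv⟩
    refine ⟨K ⊔ k ∙ x, ?_, fun v => ?_⟩
    · have hx0 : x ≠ 0 := fun h => hxK (h ▸ K.zero_mem)
      have h := Submodule.finrank_sup_add_finrank_inf_eq K (k ∙ x)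
      have hdx : Disjoint K (k ∙ x) := (Submodule.disjoint_span_singleton' hx0).2 hxK
      rw [hdx.eq_bot, finrank_bot, hK, finrank_span_singleton hx0] at h
      simpa using h
    · rw [Submodule.disjoint_def]
      intro y hy hyU
      obtain ⟨a, ha, b, hb, rfl⟩ := Submodule.mem_sup.1 hy
      obtain ⟨c, rfl⟩ := Submodule.mem_span_singleton.1 hb
      have hc : c = 0 := by
        by_contra hc
        apply hx v
        have h1 : c • x ∈ K ⊔ U v := by
          have := Submodule.sub_mem _ (Submodule.mem_sup_right hyU)
            (Submodule.mem_sup_left (S := K) (T := U v) ha)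
          simpa using this
        exact (Submodule.smul_mem_iff _ hc).1 h1
      subst hc
      simp only [zero_smul, add_zero] at hyU ⊢
      exact Submodule.disjoint_def.1 (hd v) a ha hyU

/-! ### The inertia bound -/

/-- The inertia bound for a real symmetric matrix `A = ∑ i, lam i • φ i (φ i)ᵀ`, where the `φ i`
are the rows of the orthogonal matrix `Φ`: `U` assigns orthogonal `r`-dimensional subspaces to `v`
and `w` whenever `A v w ≠ 0`. In terms of the inertia of `A` the conclusion reads
`r * n⁺ + r * n⁻ ≤ d * n⁻`, free of the truncated subtraction `d - r`. -/
theorem inertia_bound {E V : Type*} [NormedAddCommGroup E] [InnerProductSpace ℂ E]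
    [FiniteDimensional ℂ E] [Fintype V] [DecidableEq V] (U : V → Submodule ℂ E) {r : ℕ}
    (hU : ∀ v, Module.finrank ℂ (U v) = r) (lam : V → ℝ) (Φ : Matrix V V ℝ)
    (hΦ : Φ.transpose * Φ = 1)
    (h : ∀ v w, ∑ i, lam i * Φ i v * Φ i w = 0 ∨ U v ⟂ U w) :
    r * Fintype.card {i // 0 < lam i} + r * Fintype.card {i // lam i < 0} ≤
      Module.finrank ℂ E * Fintype.card {i // lam i < 0} := by
  rcases isEmpty_or_nonempty V with hV | ⟨⟨v₀⟩⟩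
  · simp
  have hr : r ≤ Module.finrank ℂ E := hU v₀ ▸ Submodule.finrank_le _
  obtain ⟨K, hK, hKU⟩ := exists_disjoint_of_finrank_add_le U hU (Module.finrank ℂ E - r) (by omega)
  let g : V → (∀ v, U v) →ₗ[ℂ] E := fun i =>
    ∑ v, (Φ i v : ℂ) • (U v).subtype ∘ₗ LinearMap.proj v
  have hg : ∀ i y, g i y = ∑ v, (Φ i v : ℂ) • (y v : E) := fun i y => by
    simp [g, LinearMap.sum_apply]
  -- the values `g i y` for `lam i < 0`, and those for `lam i = 0` modulo `K`, determine `y`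
  let L : (∀ v, U v) →ₗ[ℂ] ({i // lam i < 0} → E) × ({i // lam i = 0} → E ⧸ K) :=
    (LinearMap.pi fun i => g i.1).prod (LinearMap.pi fun i => K.mkQ ∘ₗ g i.1)
  have hL : Function.Injective L := by
    rw [injective_iff_map_eq_zero]
    intro y hy
    have hneg : ∀ i, lam i < 0 → g i y = 0 := fun i hi =>
      congrFun (congrArg Prod.fst hy) ⟨i, hi⟩
    have hzero : ∀ i, lam i = 0 → g i y ∈ K := fun i hi =>
      (Submodule.Quotient.mk_eq_zero K).1 (congrFun (congrArg Prod.snd hy) ⟨i, hi⟩)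
    have hsumC : ∑ i, (lam i : ℂ) * inner ℂ (g i y) (g i y) = 0 := by
      calc ∑ i, (lam i : ℂ) * inner ℂ (g i y) (g i y)
          = ∑ i, ∑ v, ∑ w, ((lam i * Φ i v * Φ i w : ℝ) : ℂ) * inner ℂ (y v : E) (y w : E) := by
            refine Finset.sum_congr rfl fun i _ => ?_
            simp only [hg]
            rw [sum_inner, Finset.mul_sum]
            simp only [inner_sum, inner_smul_left, inner_smul_right, Complex.conj_ofReal,
              Finset.mul_sum]
            refine Finset.sum_congr rfl fun v _ => Finset.sum_congr rfl fun w _ => ?_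
            push_cast; ring
        _ = ∑ v, ∑ w, ((∑ i, lam i * Φ i v * Φ i w : ℝ) : ℂ) * inner ℂ (y v : E) (y w : E) := by
            rw [Finset.sum_comm]
            refine Finset.sum_congr rfl fun v _ => ?_
            rw [Finset.sum_comm]
            refine Finset.sum_congr rfl fun w _ => ?_
            rw [← Finset.sum_mul, Complex.ofReal_sum]
        _ = 0 := by
            refine Finset.sum_eq_zero fun v _ => Finset.sum_eq_zero fun w _ => ?_
            rcases h v w with h | h
            · rw [h]; simp
            · rw [h.inner_eq (y v).2 (y w).2, mul_zero]
    have hsum : ∑ i, lam i * ‖g i y‖ ^ 2 = 0 := by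
      have h := congrArg Complex.re hsumC
      simp only [inner_self_eq_norm_sq_to_K, Complex.coe_algebraMap] at h
      norm_cast at h
    have hnonneg : ∀ i ∈ Finset.univ, 0 ≤ lam i * ‖g i y‖ ^ 2 := fun i _ => by
      rcases lt_or_ge (lam i) 0 with hi | hi
      · simp [hneg i hi]
      · positivity
    have hgK : ∀ i, g i y ∈ K := fun i => by
      by_cases hi : lam i = 0
      · exact hzero i hi
      · have := (Finset.sum_eq_zero_iff_of_nonneg hnonneg).1 hsum i (Finset.mem_univ i)
        have h0 : g i y = 0 := by simpa [hi] using this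
        rw [h0]; exact K.zero_mem
    ext w
    have hyw : ∑ i, (Φ i w : ℂ) • g i y = y w := by
      simp only [hg, Finset.smul_sum, smul_smul]
      rw [Finset.sum_comm]
      have hent : ∀ v, ∑ i, (Φ i w : ℂ) * (Φ i v : ℂ) = if w = v then 1 else 0 := fun v => by
        have := congrFun (congrFun hΦ w) v
        simp only [Matrix.mul_apply, Matrix.transpose_apply, Matrix.one_apply] at this
        have h2 := congrArg (fun x : ℝ => (x : ℂ)) this
        push_cast at h2
        rw [h2]
        split_ifs <;> simp
      simp_rw [← Finset.sum_smul, hent]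
      simp
    refine Submodule.disjoint_def.1 (hKU w) _ ?_ (y w).2
    rw [← hyw]
    exact K.sum_mem fun i _ => K.smul_mem _ (hgK i)
  have hdim := LinearMap.finrank_le_finrank_of_injective hL
  have hq : Module.finrank ℂ (E ⧸ K) = r := by
    have := Submodule.finrank_quotient_add_finrank K
    omega
  rw [Module.finrank_prod, Module.finrank_pi_fintype, Module.finrank_pi_fintype,
    Module.finrank_pi_fintype] at hdim
  simp only [hU, hq, Finset.sum_const, Finset.card_univ, smul_eq_mul] at hdim
  have hcard : Fintype.card V = Fintype.card {i // 0 < lam i} + Fintype.card {i // lam i < 0}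
      + Fintype.card {i // lam i = 0} := by
    simp only [Fintype.card_subtype]
    rw [← Finset.card_union_of_disjoint, ← Finset.card_union_of_disjoint, ← Finset.card_univ]
    · congr 1; ext i
      rcases lt_trichotomy (lam i) 0 with hi | hi | hi <;> simp [hi]
    · rw [Finset.disjoint_left]; intro i; simp only [Finset.mem_union, Finset.mem_filter]
      rintro (⟨-, hi⟩ | ⟨-, hi⟩) ⟨-, h0⟩ <;> exact hi.ne (by simp [h0])
    · rw [Finset.disjoint_left]; intro i; simp only [Finset.mem_filter]
      rintro ⟨-, hi⟩ ⟨-, h0⟩; exact lt_asymm hi h0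
  rw [hcard] at hdim
  nlinarith

namespace SimpleGraph

/-! ### Eigenvalues of the adjacency matrix -/

section Spectrum

variable {V : Type*} [Fintype V] [DecidableEq V] (G : SimpleGraph V) [DecidableRel G.Adj]

theorem exists_spectral_factorization : ∃ Φ : Matrix V V ℝ, Φ.transpose * Φ = 1 ∧
    ∀ v w, ∑ i, G.adjMatrix_real_isHermitian.eigenvalues i * Φ i v * Φ i w =
      G.adjMatrix ℝ v w := by
  set hA := G.adjMatrix_real_isHermitian
  refine ⟨(hA.eigenvectorUnitary : Matrix V V ℝ).transpose, ?_, fun v w => ?_⟩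
  · have : (hA.eigenvectorUnitary : Matrix V V ℝ) *
        star (hA.eigenvectorUnitary : Matrix V V ℝ) = 1 :=
      Unitary.coe_mul_star_self hA.eigenvectorUnitary
    rwa [Matrix.star_eq_conjTranspose, Matrix.conjTranspose_eq_transpose_of_trivial] at this
  · conv_rhs => rw [hA.spectral_theorem]
    simp [Unitary.conjStarAlgAut_apply, Matrix.mul_apply, Matrix.diagonal_apply,
      Matrix.star_apply]
    refine Finset.sum_congr rfl fun i _ => ?_
    ring

/-- The eigenvalues sum to the trace, which is `0`, and do not all vanish. -/
theorem exists_pos_and_neg_eigenvalue (hG : G.edgeSet.Nonempty) :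
    (∃ i, 0 < G.adjMatrix_real_isHermitian.eigenvalues i) ∧
      ∃ i, G.adjMatrix_real_isHermitian.eigenvalues i < 0 := by
  set hA := G.adjMatrix_real_isHermitian
  have hsum : ∑ i, hA.eigenvalues i = 0 := by
    have h := hA.trace_eq_sum_eigenvalues
    rw [trace_adjMatrix] at h
    exact_mod_cast h.symm
  have hne : ∃ i ∈ Finset.univ, hA.eigenvalues i ≠ 0 := by
    by_contra! h0
    obtain ⟨e, he⟩ := hG
    induction e with
    | _ v w =>
      have h1 : G.adjMatrix ℝ = 0 := hA.eigenvalues_eq_zero_iff.1 (funext fun i => h0 i (by simp))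
      have h2 : G.adjMatrix ℝ v w = 1 := by simpa using he
      rw [h1] at h2
      simp at h2
  obtain ⟨i, -, hi⟩ := Finset.exists_pos_of_sum_zero_of_exists_nonzero _ hsum hne
  obtain ⟨j, -, hj⟩ := Finset.exists_pos_of_sum_zero_of_exists_nonzero (fun i => -hA.eigenvalues i)
    (by rw [Finset.sum_neg_distrib, hsum, neg_zero]) (by simpa using hne)
  exact ⟨⟨i, hi⟩, ⟨j, neg_pos.1 hj⟩⟩

end Spectrum

/-! ### Ranges of a projective representation -/

theorem IsProjectiveRepresentation.exists_isOrtho {V : Type*} {G : SimpleGraph V} {d r : ℕ}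
    {P : V → Matrix (Fin d) (Fin d) ℂ} (hP : G.IsProjectiveRepresentation d r P) :
    ∃ U : V → Submodule ℂ (EuclideanSpace ℂ (Fin d)), (∀ v, Module.finrank ℂ (U v) = r) ∧
      ∀ v w, G.Adj v w → U v ⟂ U w := by
  obtain ⟨hproj, hrank, hmul⟩ := hP
  refine ⟨fun v => LinearMap.range (Matrix.toEuclideanLin (P v)), fun v => ?_, fun v w hvw => ?_⟩
  · rw [← hrank v, Matrix.rank_eq_finrank_range_toLin _ (EuclideanSpace.basisFun _ ℂ).toBasis
      (EuclideanSpace.basisFun _ ℂ).toBasis, Matrix.toEuclideanLin_eq_toLin_orthonormal]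
  · rw [Submodule.isOrtho_iff_inner_eq]
    rintro _ ⟨a, rfl⟩ _ ⟨b, rfl⟩
    have hstar : (P v).conjTranspose = P v := (hproj v).isSelfAdjoint
    rw [← LinearMap.adjoint_inner_right, ← Matrix.toEuclideanLin_conjTranspose_eq_adjoint, hstar]
    have : Matrix.toEuclideanLin (P v) (Matrix.toEuclideanLin (P w) b) = 0 := by
      simp [Matrix.toLpLin_apply, hmul v w hvw]
    rw [this, inner_zero_right]

/-! ### From fractional colorings to projective representations -/

/-- Given a finite family `J` of independent sets, indexed by `ι` so that repetitions are allowed,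
in which every vertex occurs at least `N` times, coordinate projectors on `ℂ^ι` form a
`|ι|/N`-representation. -/
theorem exists_isProjectiveRepresentation_of_multiset {V ι : Type*} [Fintype ι] (G : SimpleGraph V)
    (J : ι → Set V) (hJ : ∀ a, G.IsIndepSet (J a)) (N : ℕ)
    (hN : ∀ v, N ≤ Nat.card {a // v ∈ J a}) :
    ∃ P, G.IsProjectiveRepresentation (Fintype.card ι) N P := by
  classical
  have hS : ∀ v, ∃ S : Finset ι, (∀ a ∈ S, v ∈ J a) ∧ S.card = N := fun v => by
    have h := hN v
    rw [Nat.card_eq_fintype_card, Fintype.card_subtype] at h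
    obtain ⟨S, hS, hc⟩ := Finset.exists_subset_card_eq h
    exact ⟨S, fun a ha => (Finset.mem_filter.1 (hS ha)).2, hc⟩
  choose S hS hcard using hS
  let e := Fintype.equivFin ι
  refine ⟨fun v => Matrix.diagonal fun i => if e.symm i ∈ S v then 1 else 0, fun v => ⟨?_, ?_⟩,
    fun v => ?_, fun v w hvw => ?_⟩
  · rw [IsIdempotentElem, Matrix.diagonal_mul_diagonal]
    simp
  · rw [IsSelfAdjoint, Matrix.star_eq_conjTranspose, Matrix.diagonal_conjTranspose]
    congr 1; ext i
    by_cases h : e.symm i ∈ S v <;> simp [h]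
  · rw [Matrix.rank_diagonal, ← hcard v, ← Fintype.card_coe]
    refine Fintype.card_congr (e.symm.subtypeEquiv fun i => ?_)
    simp
  · rw [Matrix.diagonal_mul_diagonal, ← Matrix.diagonal_zero]
    congr 1; ext i
    by_cases h : e.symm i ∈ S v
    · have h' : e.symm i ∉ S w := fun h' => hJ _ (hS v _ h) (hS w _ h') hvw.ne hvw
      simp [h']
    · simp [h]

theorem projectiveRank_le_fractionalChromaticNumber {V : Type*} [Fintype V] (G : SimpleGraph V) :
    G.projectiveRank ≤ G.fractionalChromaticNumber := by
  classical
  obtain ⟨σ, ⟨hσ0, hσ1⟩, hσ⟩ := G.isLeast_fractionalChromaticNumber.1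
  have key : ∀ N : ℕ, 0 < N →
      G.projectiveRank ≤ G.fractionalChromaticNumber + Fintype.card G.IndepSets / N := by
    intro N hN
    have hN' : (0 : ℝ) < N := by exact_mod_cast hN
    let m : G.IndepSets → ℕ := fun J => ⌈N * σ J⌉₊
    obtain ⟨P, hP⟩ := G.exists_isProjectiveRepresentation_of_multiset (ι := Σ J, Fin (m J))
      (fun a => (a.1.1 : Set V)) (fun a => a.1.2) N fun v => by
        have hcard : Nat.card {a : Σ J, Fin (m J) // v ∈ (a.1.1 : Set V)} =
            ∑ J : G.IndepSets with v ∈ J.1, m J := by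
          rw [Nat.card_eq_fintype_card, Fintype.card_subtype]
          have : (Finset.univ.filter fun a : Σ J, Fin (m J) => v ∈ (a.1.1 : Set V)) =
              (Finset.univ.filter fun J : G.IndepSets => v ∈ J.1).sigma
                fun _ => Finset.univ := by
            ext a; simp
          rw [this, Finset.card_sigma]
          simp
        rw [hcard]
        have : (N : ℝ) ≤ ((∑ J : G.IndepSets with v ∈ J.1, m J : ℕ) : ℝ) := by
          calc (N : ℝ) ≤ N * ∑ J : G.IndepSets with v ∈ J.1, σ J :=
                le_mul_of_one_le_right hN'.le (hσ1 v)
            _ = ∑ J : G.IndepSets with v ∈ J.1, N * σ J := Finset.mul_sum _ _ _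
            _ ≤ ∑ J : G.IndepSets with v ∈ J.1, (m J : ℝ) :=
                Finset.sum_le_sum fun J _ => Nat.le_ceil _
            _ = _ := by push_cast; rfl
        exact_mod_cast this
    refine (csInf_le G.bddBelow_projectiveRankValues ⟨_, N, hN, ⟨P, hP⟩, rfl⟩).trans ?_
    rw [div_le_iff₀ hN', add_mul, div_mul_cancel₀ _ hN'.ne', Fintype.card_sigma]
    simp only [Fintype.card_fin]
    push_cast
    calc ∑ J, (m J : ℝ) ≤ ∑ J, (N * σ J + 1) :=
          Finset.sum_le_sum fun J _ => (Nat.ceil_lt_add_one (mul_nonneg hN'.le (hσ0 J))).le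
      _ = _ := by
          rw [Finset.sum_add_distrib, ← Finset.mul_sum, hσ]
          simp [mul_comm]
  have hlim : Filter.Tendsto (fun N : ℕ => G.fractionalChromaticNumber +
      (Fintype.card G.IndepSets : ℝ) / N) Filter.atTop (nhds G.fractionalChromaticNumber) := by
    simpa using (tendsto_const_div_atTop_nhds_zero_nat (Fintype.card G.IndepSets : ℝ)).const_add
      G.fractionalChromaticNumber
  refine ge_of_tendsto hlim ?_
  filter_upwards [Filter.eventually_gt_atTop 0] with N hN using key N hN

end SimpleGraph

/-! ### The two inequalities -/

/-- Inertia bound for the fractional chromatic number and the projective rank of a finite simple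
graph with at least one edge (so that `n⁺` and `n⁻` are positive and both quotients make sense). -/
theorem corollary1p4 {V : Type*} [Fintype V] [DecidableEq V] (G : SimpleGraph V)
    [DecidableRel G.Adj] (hG : G.edgeSet.Nonempty) :
    (0 < G.posInertia ∧ 0 < G.negInertia) ∧
    G.projectiveRank ≤ G.fractionalChromaticNumber ∧
    1 + max ((G.posInertia : ℝ) / G.negInertia) ((G.negInertia : ℝ) / G.posInertia) ≤
      G.projectiveRank := by
  obtain ⟨⟨i, hi⟩, ⟨j, hj⟩⟩ := G.exists_pos_and_neg_eigenvalue hG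
  have hpos : 0 < G.posInertia := Fintype.card_pos_iff.2 ⟨⟨i, hi⟩⟩
  have hneg : 0 < G.negInertia := Fintype.card_pos_iff.2 ⟨⟨j, hj⟩⟩
  refine ⟨⟨hpos, hneg⟩, G.projectiveRank_le_fractionalChromaticNumber, ?_⟩
  refine le_csInf G.projectiveRankValues_nonempty ?_
  rintro _ ⟨d, r, hr, ⟨P, hP⟩, rfl⟩
  obtain ⟨U, hU, hort⟩ := hP.exists_isOrtho
  obtain ⟨Φ, hΦ, hA⟩ := G.exists_spectral_factorization
  have horth : ∀ v w, G.adjMatrix ℝ v w = 0 ∨ U v ⟂ U w := fun v w => by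
    by_cases hvw : G.Adj v w
    · exact Or.inr (hort v w hvw)
    · exact Or.inl (by simp [hvw])
  have h₁ : r * G.posInertia + r * G.negInertia ≤ d * G.negInertia := by
    have := inertia_bound U hU G.adjMatrix_real_isHermitian.eigenvalues Φ hΦ
      fun v w => by rw [hA]; exact horth v w
    rwa [finrank_euclideanSpace_fin] at this
  have h₂ : r * G.negInertia + r * G.posInertia ≤ d * G.posInertia := by
    have := inertia_bound U hU (fun i => -G.adjMatrix_real_isHermitian.eigenvalues i) Φ hΦ
      fun v w => by
        simp only [neg_mul, Finset.sum_neg_distrib, hA, neg_eq_zero]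
        exact horth v w
    simp only [finrank_euclideanSpace_fin, neg_pos, neg_lt_zero] at this
    exact this
  have hr' : (0 : ℝ) < r := by exact_mod_cast hr
  have hquot : ∀ a b : ℕ, 0 < b → r * a + r * b ≤ d * b → 1 + (a : ℝ) / b ≤ (d : ℝ) / r := by
    intro a b hb hab
    have hb' : (0 : ℝ) < b := by exact_mod_cast hb
    have hab' : (r * a + r * b : ℝ) ≤ d * b := by exact_mod_cast hab
    rw [← div_self hb'.ne', ← add_div, div_le_div_iff₀ hb' hr']
    linarith
  rw [← max_add_add_left]
  exact max_le (hquot _ _ hneg h₁) (hquot _ _ hpos h₂)
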